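/- Let $T_1(x)=\frac13x$ and $T_2(x)=\frac13x+\frac23$ on $\mathbb R$, and let $P$ be the unique Borel probability measure on $\mathbb R$ with $P=\frac12P\circ T_1^{-1}+\frac12P\circ T_2^{-1}$ (the Cantor distribution), regarded as a measure on $\mathbb R^2$ through $x\mapsto(x,0)$. Let $V$ be the variance of a random variable $X$ with law $P$. For a word $\sigma=\sigma_1\cdots\sigma_k\in\{1,2\}^k$ put $T_\sigma=T_{\sigma_1}\circ\cdots\circ T_{\sigma_k}$, $J_\sigma=T_\sigma([0,1])$ and $a(\sigma)=E(X: X\in J_\sigma)=\frac1{P(J_\sigma)}\int_{J_\sigma}x\,dP(x)$. For $j\in\mathbb N=\{1,2,\dots\}$ let $S_j=\{(x,y): 0\le x\le 1,\ y=1+\frac1j\}$. For a nonempty finite $\alpha\subset\mathbb R^2$ let $V(P;\alpha)=\int\min_{a\in\alpha}\|x-a\|^2\,dP(x)$ (Euclidean norm), and for $n\in\mathbb N$ let $$V_n=\inf\Big\{V(P;\alpha):\ \alpha\subseteq\bigcup_{j=1}^nS_j,\ 1\le\operatorname{card}(\alpha)\le n\Big\}.$$ A set $\alpha\subseteq\bigcup_{j=1}^nS_j$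 with $1\le\operatorname{card}(\alpha)\le n$ and $V(P;\alpha)=V_n$ is called an optimal set of $n$-points. Theorem. (a) For every $n\ge1$, every optimal set of $n$-points is contained in $S_n$. (b) Let $n\ge2$ and let $\ell(n)$ be the unique natural number with $2^{\ell(n)}\le n<2^{\ell(n)+1}$. For $I\subseteq\{1,2\}^{\ell(n)}$ with $\operatorname{card}(I)=n-2^{\ell(n)}$ let $$\alpha_n(I)=\{(a(\sigma),1+\tfrac1n):\sigma\in\{1,2\}^{\ell(n)}\setminus I\}\cup\{(a(\sigma1),1+\tfrac1n):\sigma\in I\}\cup\{(a(\sigma2),1+\tfrac1n):\sigma\in I\}.$$ Then a set is an optimal set of $n$-points if and only if it equals $\alpha_n(I)$ for some such $I$, and $$V_n=\frac1{18^{\ell(n)}}\,V\Big(2^{\ell(n)+1}-n+\frac19\big(n-2^{\ell(n)}\big)\Big)+\Big(1+\frac1n\Big)^2.$$ -/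

import Mathlib

open MeasureTheory ProbabilityTheory
open scoped ENNReal

noncomputable section

namespace CantorQuant

/-- The Euclidean plane. -/
abbrev Plane : Type := EuclideanSpace ℝ (Fin 2)

/-! ### Constrained quantization (of order two, in the Euclidean plane) -/

/-- The distortion error `∫ min_{a ∈ α} ‖x - a‖² dQ(x)` of a Borel measure `Q` on the plane with
respect to `α` (used for nonempty finite `α` and `Q` with finite second moment). -/
def distortion (Q : Measure Plane) (α : Set Plane) : ℝ :=
  ∫ x, ⨅ a : α, dist x (a : Plane) ^ 2 ∂Q

/-- The competitors at stage `n`: sets `α ⊆ S₁ ∪ ⋯ ∪ Sₙ` with `1 ≤ card α ≤ n`. -/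
def IsAdmissible (S : ℕ → Set Plane) (n : ℕ) (α : Set Plane) : Prop :=
  α ⊆ (⋃ j ∈ Set.Icc 1 n, S j) ∧ 1 ≤ α.encard ∧ α.encard ≤ n

/-- The `n`-th constrained quantization error of `Q` with respect to the constraints `S`. -/
def quantError (S : ℕ → Set Plane) (Q : Measure Plane) (n : ℕ) : ℝ :=
  sInf {v : ℝ | ∃ α : Set Plane, IsAdmissible S n α ∧ v = distortion Q α}

/-- `α` is an optimal set of `n`-points for `Q` with respect to the constraints `S`: it is a
competitor at which the infimum is attained. -/
def IsOptimal (S : ℕ → Set Plane) (Q : Measure Plane) (n : ℕ) (α : Set Plane) : Prop :=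
  IsAdmissible S n α ∧ distortion Q α = quantError S Q n

/-! ### The Cantor distribution -/

/-- The two contractions `x ↦ x/3` and `x ↦ x/3 + 2/3`. The letters `1, 2` of the alphabet are
represented by `0, 1 : Fin 2`. -/
def T (i : Fin 2) : ℝ → ℝ := ![fun x => 1 / 3 * x, fun x => 1 / 3 * x + 2 / 3] i

/-- `T_σ = T_{σ₁} ∘ ⋯ ∘ T_{σ_k}` for a word `σ`. -/
def Tword : List (Fin 2) → ℝ → ℝ
  | [] => id
  | i :: σ => T i ∘ Tword σ

/-- The basic interval `J_σ = T_σ [0, 1]`. -/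
def J (σ : List (Fin 2)) : Set ℝ := Tword σ '' Set.Icc 0 1

/-- The law of a fair coin with values in the alphabet. -/
def coin : Measure (Fin 2) := (2⁻¹ : ℝ≥0∞) • (Measure.dirac 0 + Measure.dirac 1)

instance : IsProbabilityMeasure coin :=
  ⟨by simpa [coin] using ENNReal.inv_two_add_inv_two⟩

/-- The point of the Cantor set with ternary digits `2 ω₀, 2 ω₁, …`. -/
def digitSum (ω : ℕ → Fin 2) : ℝ := ∑' k, 2 * (ω k : ℝ) / 3 ^ (k + 1)

/-- The Cantor distribution `P`, as the law of a random ternary expansion with independent fair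
digits in `{0, 2}`. By `cantorMeasure_selfSimilar` and `eq_cantorMeasure` below it is the unique
Borel probability measure with `P = ½ P ∘ T₁⁻¹ + ½ P ∘ T₂⁻¹`. -/
def cantorMeasure : Measure ℝ := (Measure.infinitePi fun _ : ℕ => coin).map digitSum

lemma summable_digits (ω : ℕ → Fin 2) : Summable fun k => 2 * (ω k : ℝ) / 3 ^ (k + 1) := by
  refine Summable.of_nonneg_of_le (fun k => by positivity) (fun k => ?_)
    (summable_geometric_of_lt_one (r := (1 / 3 : ℝ)) (by norm_num) (by norm_num))
  have h : (ω k : ℝ) ≤ 1 := by exact_mod_cast Nat.lt_succ_iff.mp (ω k).isLt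
  rw [div_pow, one_pow, pow_succ, div_le_div_iff₀ (by positivity) (by positivity)]
  have : (0 : ℝ) < 3 ^ k := by positivity
  nlinarith

lemma measurable_digitSum : Measurable digitSum := by
  refine measurable_of_tendsto_metrizable (f := fun N ω => ∑ k ∈ Finset.range N,
    2 * (((ω : ℕ → Fin 2) k : ℕ) : ℝ) / 3 ^ (k + 1)) (fun N => ?_) ?_
  · refine Finset.measurable_sum _ fun k _ => ?_
    exact (measurable_of_countable fun b : Fin 2 => 2 * ((b : ℕ) : ℝ) / 3 ^ (k + 1)).comp
      (measurable_pi_apply k)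
  · rw [tendsto_pi_nhds]
    exact fun ω => (summable_digits ω).hasSum.tendsto_sum_nat

instance : IsProbabilityMeasure cantorMeasure :=
  Measure.isProbabilityMeasure_map measurable_digitSum.aemeasurable

lemma measurable_T (i : Fin 2) : Measurable (T i) := by
  fin_cases i <;> simp [T] <;> fun_prop

/-- Prepending a letter to an infinite word. -/
def consWord (p : Fin 2 × (ℕ → Fin 2)) : ℕ → Fin 2
  | 0 => p.1
  | k + 1 => p.2 k

lemma measurable_consWord : Measurable consWord := by
  refine measurable_pi_lambda _ fun k => ?_
  cases k with
  | zero => exact measurable_fst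
  | succ k => exact (measurable_pi_apply k).comp measurable_snd

lemma digitSum_consWord (p : Fin 2 × (ℕ → Fin 2)) :
    digitSum (consWord p) = T p.1 (digitSum p.2) := by
  obtain ⟨b, ω⟩ := p
  rw [digitSum, (summable_digits _).tsum_eq_zero_add]
  have h : ∀ k, 2 * (consWord (b, ω) (k + 1) : ℝ) / 3 ^ (k + 1 + 1)
      = 1 / 3 * (2 * (ω k : ℝ) / 3 ^ (k + 1)) := fun k => by
    simp only [consWord]; field_simp; ring
  simp_rw [h]
  rw [tsum_mul_left]
  fin_cases b <;> simp [consWord, T, digitSum, add_comm]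

lemma map_consWord : (coin.prod (Measure.infinitePi fun _ : ℕ => coin)).map consWord
    = Measure.infinitePi fun _ : ℕ => coin := by
  classical
  refine Measure.eq_infinitePi _ fun s t ht => ?_
  obtain ⟨N, hN⟩ := s.exists_nat_subset_range
  let t' : ℕ → Set (Fin 2) := fun i => if i ∈ s then t i else Set.univ
  have hset : consWord ⁻¹' Set.pi s t
      = t' 0 ×ˢ Set.pi (Finset.range N) (fun k => t' (k + 1)) := by
    ext ⟨b, ω⟩
    simp only [Set.mem_preimage, Set.mem_pi, Set.mem_prod, t', Finset.coe_range, Set.mem_Iio,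
      Finset.mem_coe]
    constructor
    · intro h
      refine ⟨?_, fun k _ => ?_⟩
      · split_ifs with h0
        · exact h 0 h0
        · trivial
      · split_ifs with h0
        · exact h (k + 1) h0
        · trivial
    · rintro ⟨h0, h1⟩ k hk
      cases k with
      | zero => simpa [hk, consWord] using h0
      | succ k =>
        have hkN := Finset.mem_range.mp (hN hk)
        have := h1 k (by omega)
        simpa [hk, consWord] using this
  rw [Measure.map_apply measurable_consWord
    (MeasurableSet.pi s.countable_toSet fun i _ => ht i), hset, Measure.prod_prod,
    Measure.infinitePi_pi _ (fun i _ => MeasurableSet.of_discrete), mul_comm,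
    ← Finset.prod_range_succ' (fun i => coin (t' i))]
  have hsub : s ⊆ Finset.range (N + 1) := hN.trans (Finset.range_mono (by omega))
  rw [← Finset.prod_subset hsub (fun i _ hi => by simp [t', hi])]
  exact Finset.prod_congr rfl fun i hi => by simp [t', hi]

theorem cantorMeasure_selfSimilar : cantorMeasure =
    (2⁻¹ : ℝ≥0∞) • cantorMeasure.map (T 0) + (2⁻¹ : ℝ≥0∞) • cantorMeasure.map (T 1) := by
  have h1 : ∀ i, Measurable fun ω => consWord (i, ω) := fun i =>
    measurable_consWord.comp measurable_prodMk_left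
  have h2 : ∀ i, cantorMeasure.map (T i)
      = (Measure.infinitePi fun _ : ℕ => coin).map fun ω => digitSum (consWord (i, ω)) := by
    intro i
    rw [cantorMeasure, Measure.map_map (measurable_T i) measurable_digitSum]
    exact congrArg (fun f => Measure.map f _) (funext fun ω => (digitSum_consWord (i, ω)).symm)
  rw [h2, h2]
  conv_lhs => rw [cantorMeasure, ← map_consWord,
    Measure.map_map measurable_digitSum measurable_consWord]
  have hm : Measurable (digitSum ∘ consWord) := measurable_digitSum.comp measurable_consWord
  generalize hμ : (Measure.infinitePi fun _ : ℕ => coin) = μ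
  have : IsProbabilityMeasure μ := hμ ▸ inferInstance
  rw [coin, Measure.prod_smul_left, Measure.add_prod, Measure.dirac_prod, Measure.dirac_prod,
    Measure.map_smul, Measure.map_add _ _ hm, Measure.map_map hm measurable_prodMk_left,
    Measure.map_map hm measurable_prodMk_left, smul_add]
  rfl

/-- Uniqueness of the self-similar probability measure. -/
theorem eq_cantorMeasure (P : Measure ℝ) [IsProbabilityMeasure P]
    (hP : P = (2⁻¹ : ℝ≥0∞) • P.map (T 0) + (2⁻¹ : ℝ≥0∞) • P.map (T 1)) :
    P = cantorMeasure := by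
  have key : ∀ (Q : Measure ℝ) [IsProbabilityMeasure Q],
      Q = (2⁻¹ : ℝ≥0∞) • Q.map (T 0) + (2⁻¹ : ℝ≥0∞) • Q.map (T 1) → ∀ t : ℝ,
      charFun Q t = (1 + Complex.exp (t * (2 / 3) * Complex.I)) / 2 * charFun Q (t / 3) := by
    intro Q _ hQ t
    have hint : ∀ i, Integrable (fun x : ℝ => Complex.exp (t * x * Complex.I)) (Q.map (T i)) := by
      intro i
      have := Measure.isProbabilityMeasure_map (μ := Q) (measurable_T i).aemeasurable
      refine Integrable.of_bound (C := 1) (by fun_prop) (Filter.Eventually.of_forall fun x => ?_)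
      rw [← Complex.ofReal_mul, Complex.norm_exp_ofReal_mul_I]
    have hs : (2⁻¹ : ℝ≥0∞) ≠ ∞ := by simp
    rw [charFun_apply_real]
    conv_lhs => rw [hQ]
    rw [integral_add_measure ((hint 0).smul_measure hs) ((hint 1).smul_measure hs),
      integral_smul_measure, integral_smul_measure,
      integral_map (measurable_T 0).aemeasurable (hint 0).aestronglyMeasurable,
      integral_map (measurable_T 1).aemeasurable (hint 1).aestronglyMeasurable,
      charFun_apply_real]
    have e0 : ∀ x : ℝ, Complex.exp (t * (T 0 x : ℝ) * Complex.I)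
        = Complex.exp ((t / 3 : ℝ) * x * Complex.I) := fun x => by
      congr 1; simp [T]; ring
    have e1 : ∀ x : ℝ, Complex.exp (t * (T 1 x : ℝ) * Complex.I)
        = Complex.exp (t * (2 / 3) * Complex.I) * Complex.exp ((t / 3 : ℝ) * x * Complex.I) :=
      fun x => by
        rw [← Complex.exp_add]; congr 1; simp [T]; ring
    simp_rw [e0, e1]
    rw [integral_const_mul]
    simp
    ring
  refine Measure.ext_of_charFun (funext fun t => ?_)
  have hle : ∀ (k : ℕ) (t : ℝ), ‖charFun P t - charFun cantorMeasure t‖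
      ≤ ‖charFun P (t / 3 ^ k) - charFun cantorMeasure (t / 3 ^ k)‖ := by
    intro k
    induction k with
    | zero => simp
    | succ k ih =>
      intro t
      refine (ih t).trans ?_
      rw [key P hP, key _ cantorMeasure_selfSimilar, ← mul_sub, norm_mul, div_div, ← pow_succ]
      refine mul_le_of_le_one_left (norm_nonneg _) ?_
      rw [norm_div, Complex.norm_ofNat, div_le_one (by norm_num)]
      refine (norm_add_le _ _).trans ?_
      have : ((t / 3 ^ k : ℝ) : ℂ) * (2 / 3) * Complex.I
          = ((t / 3 ^ k * (2 / 3) : ℝ) : ℂ) * Complex.I := by push_cast; ring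
      rw [this, Complex.norm_exp_ofReal_mul_I]
      norm_num
  have hlim : Filter.Tendsto (fun k : ℕ => ‖charFun P (t / 3 ^ k)
      - charFun cantorMeasure (t / 3 ^ k)‖) Filter.atTop (nhds 0) := by
    have h0 : Filter.Tendsto (fun k : ℕ => t / (3 : ℝ) ^ k) Filter.atTop (nhds 0) := by
      have := (tendsto_pow_atTop_nhds_zero_of_lt_one (r := (1 / 3 : ℝ)) (by norm_num)
        (by norm_num)).const_mul t
      simpa [div_eq_mul_inv] using this
    have hc : Continuous fun s : ℝ => ‖charFun P s - charFun cantorMeasure s‖ :=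
      (continuous_charFun.sub continuous_charFun).norm
    simpa [Function.comp_def] using (hc.tendsto 0).comp h0
  have := ge_of_tendsto' hlim fun k => hle k t
  exact sub_eq_zero.mp (norm_le_zero_iff.mp this)

/-- The Cantor distribution on the plane, through the identification of `x` with `(x, 0)`. -/
def planeCantor : Measure Plane := cantorMeasure.map fun x => !₂[x, 0]

/-- The variance `V` of a random variable with law `P`. -/
def V : ℝ := Var[id; cantorMeasure]

/-- `a(σ) = E(X : X ∈ J_σ) = P(J_σ)⁻¹ ∫_{J_σ} x dP`. -/
def condMean (σ : List (Fin 2)) : ℝ :=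
  (cantorMeasure.real (J σ))⁻¹ * ∫ x in J σ, x ∂cantorMeasure

/-! ### The constraints and the candidate sets -/

/-- The constraint `S_j = {(x, y) : 0 ≤ x ≤ 1, y = 1 + 1/j}` (for `j ≥ 1`). -/
def constraintSet (j : ℕ) : Set Plane :=
  {p | 0 ≤ p 0 ∧ p 0 ≤ 1 ∧ p 1 = 1 + 1 / (j : ℝ)}

/-- The set `α_n(I)`, with `ℓ = ℓ(n)` and `I` a set of words of length `ℓ`:
the points `(a(σ), 1 + 1/n)` for words `σ ∉ I` of length `ℓ`, together with
`(a(σ1), 1 + 1/n)` and `(a(σ2), 1 + 1/n)` for `σ ∈ I`. -/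
def alphaSet (n ℓ : ℕ) (I : Finset (List (Fin 2))) : Set Plane :=
  {p | ∃ σ : List (Fin 2), σ.length = ℓ ∧ σ ∉ I ∧ p = !₂[condMean σ, 1 + 1 / (n : ℝ)]} ∪
  {p | ∃ σ ∈ I, p = !₂[condMean (σ ++ [0]), 1 + 1 / (n : ℝ)]} ∪
  {p | ∃ σ ∈ I, p = !₂[condMean (σ ++ [1]), 1 + 1 / (n : ℝ)]}

end CantorQuant

end

noncomputable section

namespace CantorQuant

/-! The squared distance from `(x, 0)` to `p` is `(x - p 0)^2 + (p 1)^2`, and every competitor has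
height at least `1 + 1/n`. So the problem reduces to quantizing the Cantor distribution on the line,
plus the constant `(1 + 1/n)^2`.

On the line, self-similarity gives `lineDistortion B` as one eighteenth of the sum of the errors of
the two rescaled copies of `B` (`lineDistortion_eq`). The affine functions `envelope ℓ` satisfy the
same recursion exactly (`envelope_succ`). Hence `envelope_le_lineDistortion`, the heart of the
proof, goes by induction on `ℓ`: if no point of `B` is nearest to points of both thirds, `B` splits
into two disjoint parts and the induction hypothesis applies to each; if some point serves both
thirds, explicit estimates show that `B` is strictly worse than the bound
(`envelope_lt_of_not_disjoint`). Since `envelope ℓ` is strictly decreasing, equality forces every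
point to be used and both parts to be extremal, which by recursion yields exactly the sets `betaSet
ℓ I`. The bound holds for every `ℓ`, so no optimization over the sizes of the two parts is needed.

Conversely the sets `betaSet ℓ I` reach the bound (`exists_finset_eq_betaSet`). In the plane,
equality makes points at minimal height serve almost every `x` (`exists_flat_subset`); by strict
monotonicity again no other points can be present. -/

/-! ### Integration against the Cantor distribution: moments and symmetry -/

lemma digitSum_mem_Icc (ω : ℕ → Fin 2) : digitSum ω ∈ Set.Icc (0 : ℝ) 1 := by
  have hg : HasSum (fun k : ℕ => 2 / 3 * (1 / 3 : ℝ) ^ k) 1 := by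
    have := (hasSum_geometric_of_lt_one (r := (1 / 3 : ℝ)) (by norm_num) (by norm_num)).mul_left
      (2 / 3)
    norm_num at this ⊢
    exact this
  refine ⟨tsum_nonneg fun k => by positivity, ?_⟩
  refine hasSum_le (fun k => ?_) (summable_digits ω).hasSum hg
  have h : (ω k : ℝ) ≤ 1 := by exact_mod_cast Nat.lt_succ_iff.mp (ω k).isLt
  have h3 : (0 : ℝ) < 3 ^ k := by positivity
  rw [one_div, inv_pow, pow_succ, div_mul_eq_mul_div, ← div_eq_mul_inv, div_div, mul_comm _ (3 : ℝ)]
  gcongr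
  linarith

lemma ae_mem_Icc : ∀ᵐ x ∂cantorMeasure, x ∈ Set.Icc (0 : ℝ) 1 := by
  exact (ae_map_iff measurable_digitSum.aemeasurable measurableSet_Icc).mpr
    (Filter.Eventually.of_forall digitSum_mem_Icc)

lemma integrable_of_continuous {g : ℝ → ℝ} (hg : Continuous g) : Integrable g cantorMeasure := by
  have h := hg.integrableOn_Icc (μ := cantorMeasure) (a := 0) (b := 1)
  rwa [IntegrableOn, Measure.restrict_eq_self_of_ae_mem ae_mem_Icc] at h

lemma integral_mono_Icc {f g : ℝ → ℝ} (hf : Continuous f) (hg : Continuous g)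
    (h : ∀ x, 0 ≤ x → x ≤ 1 → f x ≤ g x) :
    ∫ x, f x ∂cantorMeasure ≤ ∫ x, g x ∂cantorMeasure :=
  integral_mono_ae (integrable_of_continuous hf) (integrable_of_continuous hg)
    (ae_mem_Icc.mono fun x hx => h x hx.1 hx.2)

lemma integral_congr_Icc {f g : ℝ → ℝ} (h : ∀ x, 0 ≤ x → x ≤ 1 → f x = g x) :
    ∫ x, f x ∂cantorMeasure = ∫ x, g x ∂cantorMeasure :=
  integral_congr_ae (ae_mem_Icc.mono fun x hx => h x hx.1 hx.2)

lemma T_zero (x : ℝ) : T 0 x = x / 3 := by simp [T]; ring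

lemma T_one (x : ℝ) : T 1 x = x / 3 + 2 / 3 := by simp [T]; ring

lemma integral_selfSimilar {g : ℝ → ℝ} (hg : Integrable g cantorMeasure) :
    ∫ x, g x ∂cantorMeasure
      = (∫ x, g (T 0 x) ∂cantorMeasure + ∫ x, g (T 1 x) ∂cantorMeasure) / 2 := by
  have h := hg
  rw [cantorMeasure_selfSimilar, integrable_add_measure] at h
  have hs : (2⁻¹ : ℝ≥0∞) ≠ ∞ := by simp
  have h0 := (integrable_smul_measure (by simp) hs).mp h.1
  have h1 := (integrable_smul_measure (by simp) hs).mp h.2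
  conv_lhs => rw [cantorMeasure_selfSimilar]
  rw [integral_add_measure h.1 h.2, integral_smul_measure, integral_smul_measure,
    integral_map (measurable_T 0).aemeasurable h0.aestronglyMeasurable,
    integral_map (measurable_T 1).aemeasurable h1.aestronglyMeasurable]
  simp
  ring

/-- Self-similarity makes each moment the solution of a linear equation, here `m = m/3 + 1/3`; the
second moment below solves `s = s/9 + 1/3`. -/
lemma integral_id_cantor : ∫ x, x ∂cantorMeasure = 1 / 2 := by
  have h := integral_selfSimilar (integrable_of_continuous (g := fun x => x) continuous_id)
  simp only [T_zero, T_one] at h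
  have hi : Integrable (fun x : ℝ => x / 3) cantorMeasure := integrable_of_continuous (by fun_prop)
  rw [integral_add hi (integrable_const _), integral_div] at h
  simp at h
  linarith

lemma integral_sq_cantor : ∫ x, x ^ 2 ∂cantorMeasure = 3 / 8 := by
  have h := integral_selfSimilar (integrable_of_continuous (g := fun x => x ^ 2) (by fun_prop))
  simp only [T_zero, T_one] at h
  have e1 : ∀ x : ℝ, (x / 3) ^ 2 = x ^ 2 / 9 := fun x => by ring
  have e2 : ∀ x : ℝ, (x / 3 + 2 / 3) ^ 2 = x ^ 2 / 9 + (4 / 9 * x + 4 / 9) := fun x => by ring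
  simp_rw [e1, e2] at h
  have hi : Integrable (fun x : ℝ => x ^ 2 / 9) cantorMeasure :=
    integrable_of_continuous (by fun_prop)
  have hj : Integrable (fun x : ℝ => 4 / 9 * x) cantorMeasure :=
    integrable_of_continuous (by fun_prop)
  have hk : Integrable (fun x : ℝ => 4 / 9 * x + 4 / 9) cantorMeasure :=
    integrable_of_continuous (by fun_prop)
  rw [integral_add hi hk, integral_add hj (integrable_const _), integral_div,
    integral_const_mul, integral_id_cantor] at h
  simp at h
  linarith

lemma integral_quadratic (a b c : ℝ) :
    ∫ x, (a * x ^ 2 + b * x + c) ∂cantorMeasure = a * (3 / 8) + b / 2 + c := by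
  have hi : Integrable (fun x : ℝ => a * x ^ 2) cantorMeasure :=
    integrable_of_continuous (by fun_prop)
  have hj : Integrable (fun x : ℝ => b * x) cantorMeasure :=
    integrable_of_continuous (by fun_prop)
  have hk : Integrable (fun x : ℝ => a * x ^ 2 + b * x) cantorMeasure :=
    integrable_of_continuous (by fun_prop)
  rw [integral_add hk (integrable_const _), integral_add hi hj,
    integral_const_mul, integral_const_mul, integral_id_cantor, integral_sq_cantor]
  simp
  ring

lemma V_eq : V = 1 / 8 := by
  rw [V, variance_eq_integral aemeasurable_id]
  simp only [id, integral_id_cantor]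
  rw [← (by norm_num : (1 : ℝ) * (3 / 8) + (-1) / 2 + 1 / 4 = 1 / 8), ← integral_quadratic]
  exact integral_congr_ae (Filter.Eventually.of_forall fun x => by ring)

/-- The Cantor distribution is symmetric about `1 / 2`. -/
lemma map_reflect : cantorMeasure.map (fun x => 1 - x) = cantorMeasure := by
  have hr : Measurable fun x : ℝ => 1 - x := by fun_prop
  have := Measure.isProbabilityMeasure_map (μ := cantorMeasure) hr.aemeasurable
  -- Reflection interchanges `T 0` and `T 1`, so the reflected law solves the same self-similarity
  -- equation and uniqueness applies.
  refine eq_cantorMeasure _ ?_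
  conv_lhs => rw [cantorMeasure_selfSimilar]
  rw [Measure.map_add _ _ hr, Measure.map_smul, Measure.map_smul, Measure.map_map hr (measurable_T _),
    Measure.map_map hr (measurable_T _), Measure.map_map (measurable_T _) hr,
    Measure.map_map (measurable_T _) hr, add_comm]
  have h0 : (fun x : ℝ => 1 - x) ∘ T 1 = T 0 ∘ fun x => 1 - x := by
    funext x; simp only [Function.comp, T_zero, T_one]; ring
  have h1 : (fun x : ℝ => 1 - x) ∘ T 0 = T 1 ∘ fun x => 1 - x := by
    funext x; simp only [Function.comp, T_zero, T_one]; ring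
  rw [h0, h1]

lemma integral_reflect (g : ℝ → ℝ) :
    ∫ x, g (1 - x) ∂cantorMeasure = ∫ x, g x ∂cantorMeasure := by
  conv_rhs => rw [← map_reflect]
  exact ((Homeomorph.subLeft (1 : ℝ)).measurableEmbedding.integral_map g).symm

/-! ### Conditional means on the basic intervals -/

lemma continuous_T (i : Fin 2) : Continuous (T i) := by
  fin_cases i
  · simp only [Fin.zero_eta, funext T_zero]; fun_prop
  · simp only [Fin.mk_one, funext T_one]; fun_prop

lemma T_mem_Icc {i : Fin 2} {x : ℝ} (hx : x ∈ Set.Icc (0 : ℝ) 1) : T i x ∈ Set.Icc (0 : ℝ) 1 := by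
  obtain ⟨h0, h1⟩ := hx
  fin_cases i
  · simp only [Fin.zero_eta, T_zero]; constructor <;> linarith
  · simp only [Fin.mk_one, T_one]; constructor <;> linarith

lemma T_eq_T {i j : Fin 2} {x y : ℝ} (hx : x ∈ Set.Icc (0 : ℝ) 1) (hy : y ∈ Set.Icc (0 : ℝ) 1)
    (h : T i x = T j y) : i = j ∧ x = y := by
  obtain ⟨h0, h1⟩ := hx
  obtain ⟨h2, h3⟩ := hy
  fin_cases i <;> fin_cases j <;> simp only [Fin.zero_eta, Fin.mk_one, T_zero, T_one] at h
  · exact ⟨rfl, by linarith⟩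
  · linarith
  · linarith
  · exact ⟨rfl, by linarith⟩

lemma continuous_Tword (σ : List (Fin 2)) : Continuous (Tword σ) := by
  induction σ with
  | nil => exact continuous_id
  | cons i σ ih => exact (continuous_T i).comp ih

lemma Tword_mem_Icc (σ : List (Fin 2)) {x : ℝ} (hx : x ∈ Set.Icc (0 : ℝ) 1) :
    Tword σ x ∈ Set.Icc (0 : ℝ) 1 := by
  induction σ with
  | nil => exact hx
  | cons i σ ih => exact T_mem_Icc ih

lemma measurableSet_J (σ : List (Fin 2)) : MeasurableSet (J σ) :=
  (isCompact_Icc.image (continuous_Tword σ)).measurableSet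

lemma T_mem_J_cons {i j : Fin 2} {σ : List (Fin 2)} {x : ℝ} (hx : x ∈ Set.Icc (0 : ℝ) 1) :
    T j x ∈ J (i :: σ) ↔ j = i ∧ x ∈ J σ := by
  constructor
  · rintro ⟨y, hy, h⟩
    obtain ⟨rfl, rfl⟩ := T_eq_T (Tword_mem_Icc σ hy) hx h
    exact ⟨rfl, y, hy, rfl⟩
  · rintro ⟨rfl, y, hy, rfl⟩
    exact ⟨y, hy, rfl⟩

/-- Up to a null set, only the branch of the first letter meets `J (i :: σ)`, because the two images
of `[0, 1]` are disjoint. Each letter therefore costs a factor `1/2`. -/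
lemma setIntegral_J (σ : List (Fin 2)) {g : ℝ → ℝ} (hg : Continuous g) :
    ∫ x in J σ, g x ∂cantorMeasure
      = (∫ x, g (Tword σ x) ∂cantorMeasure) / 2 ^ σ.length := by
  induction σ generalizing g with
  | nil =>
    have : J [] = Set.Icc 0 1 := by simp [J, Tword]
    rw [this, Measure.restrict_eq_self_of_ae_mem ae_mem_Icc]
    simp [Tword]
  | cons i σ ih =>
    rw [← integral_indicator (measurableSet_J _), integral_selfSimilar
      ((integrable_of_continuous hg).indicator (measurableSet_J _))]
    have key : ∀ j, ∫ x, (J (i :: σ)).indicator g (T j x) ∂cantorMeasure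
        = if j = i then ∫ x in J σ, g (T i x) ∂cantorMeasure else 0 := by
      intro j
      rw [← integral_indicator (measurableSet_J σ)]
      split_ifs with hj
      · subst hj
        refine integral_congr_Icc fun x h0 h1 => ?_
        by_cases hx : x ∈ J σ <;> simp [Set.indicator, T_mem_J_cons ⟨h0, h1⟩, hx]
      · rw [← integral_zero ℝ ℝ (μ := cantorMeasure)]
        refine integral_congr_Icc fun x h0 h1 => ?_
        simp [Set.indicator, T_mem_J_cons ⟨h0, h1⟩, hj]
    rw [key, key, ih (g := fun x => g (T i x)) (hg.comp (continuous_T i))]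
    simp only [List.length_cons, pow_succ, Tword, Function.comp]
    fin_cases i <;> simp <;> ring

lemma integral_Tword (σ : List (Fin 2)) :
    ∫ x, Tword σ x ∂cantorMeasure = Tword σ (1 / 2) := by
  induction σ with
  | nil => exact integral_id_cantor
  | cons i σ ih =>
    have hi : Integrable (fun x : ℝ => Tword σ x / 3) cantorMeasure :=
      integrable_of_continuous ((continuous_Tword σ).div_const 3)
    simp only [Tword, Function.comp]
    fin_cases i
    · simp only [Fin.zero_eta, T_zero, integral_div, ih]
    · simp only [Fin.mk_one, T_one]
      rw [integral_add hi (integrable_const _), integral_div, ih]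
      simp

lemma condMean_eq (σ : List (Fin 2)) : condMean σ = Tword σ (1 / 2) := by
  have h1 : cantorMeasure.real (J σ) = 1 / 2 ^ σ.length := by
    have := setIntegral_J σ (g := fun _ => 1) continuous_const
    simpa using this
  rw [condMean, h1, setIntegral_J σ (g := fun x => x) continuous_id,
    integral_Tword]
  field_simp

/-! ### Distortion on the line -/

/-- The distortion error of a finite set of reals for the Cantor distribution on the line. -/
def lineDistortion (B : Finset ℝ) : ℝ := ∫ x, Metric.infDist x (B : Set ℝ) ^ 2 ∂cantorMeasure

/-- The image of `B` under the inverse of `T i`. -/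
def expand (i : Fin 2) (B : Finset ℝ) : Finset ℝ := B.image fun b => 3 * b - 2 * (i : ℕ)

lemma T_eq (i : Fin 2) (x : ℝ) : T i x = (x + 2 * (i : ℕ)) / 3 := by
  fin_cases i
  · simp [T_zero]
  · simp [T_one]; ring

lemma lineDistortion_nonneg (B : Finset ℝ) : 0 ≤ lineDistortion B :=
  integral_nonneg fun _ => sq_nonneg _

lemma continuous_infDist_sq (B : Finset ℝ) :
    Continuous fun x => Metric.infDist x (B : Set ℝ) ^ 2 :=
  (Metric.continuous_infDist_pt _).pow 2

lemma exists_infDist_eq {B : Finset ℝ} (hB : B.Nonempty) (x : ℝ) :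
    ∃ b ∈ B, Metric.infDist x (B : Set ℝ) = |x - b| := by
  obtain ⟨b, hb, h⟩ := B.finite_toSet.isCompact.exists_infDist_eq_dist (by simpa using hB) x
  exact ⟨b, hb, h⟩

lemma infDist_le_abs {B : Finset ℝ} {b : ℝ} (hb : b ∈ B) (x : ℝ) :
    Metric.infDist x (B : Set ℝ) ≤ |x - b| :=
  Metric.infDist_le_dist_of_mem (by simpa using hb)

lemma expand_nonempty {i : Fin 2} {B : Finset ℝ} (hB : B.Nonempty) : (expand i B).Nonempty :=
  hB.image _

lemma card_expand (i : Fin 2) (B : Finset ℝ) : (expand i B).card = B.card :=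
  Finset.card_image_of_injective _ fun a b h => by simpa using h

lemma mem_expand {i : Fin 2} {B : Finset ℝ} {y : ℝ} : y ∈ expand i B ↔ T i y ∈ B := by
  rw [expand, Finset.mem_image, T_eq]
  constructor
  · rintro ⟨b, hb, rfl⟩
    convert hb using 1; ring
  · exact fun h => ⟨_, h, by ring⟩

lemma T_image_expand (i : Fin 2) (B : Finset ℝ) : T i '' (expand i B : Set ℝ) = B := by
  ext y
  constructor
  · rintro ⟨x, hx, rfl⟩
    exact mem_expand.mp hx
  · intro hy
    refine ⟨3 * y - 2 * (i : ℕ), Finset.mem_image_of_mem _ hy, ?_⟩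
    rw [T_eq]; ring

lemma infDist_T (i : Fin 2) {B : Finset ℝ} (hB : B.Nonempty) (x : ℝ) :
    Metric.infDist (T i x) (B : Set ℝ) = Metric.infDist x (expand i B : Set ℝ) / 3 := by
  have key : ∀ b : ℝ, |x - (3 * b - 2 * (i : ℕ))| = 3 * |T i x - b| := fun b => by
    rw [T_eq, ← abs_of_pos (three_pos (α := ℝ)), ← abs_mul, abs_of_pos (three_pos (α := ℝ))]
    congr 1; ring
  apply le_antisymm
  · obtain ⟨y, hy, h⟩ := exists_infDist_eq (expand_nonempty (i := i) hB) x
    obtain ⟨b, hb, rfl⟩ := Finset.mem_image.mp hy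
    rw [h, key]
    linarith [infDist_le_abs hb (T i x)]
  · obtain ⟨b, hb, h⟩ := exists_infDist_eq hB (T i x)
    have : Metric.infDist x (expand i B : Set ℝ) ≤ |x - (3 * b - 2 * (i : ℕ))| :=
      infDist_le_abs (Finset.mem_image_of_mem _ hb) x
    rw [key] at this
    rw [h]
    linarith

/-- `18 = 2 * 9`: each third has mass `1/2`, and contraction by `1/3` divides squared distances by
`9`. Both terms still use all of `B`; sharing out its points is a separate step. -/
lemma lineDistortion_eq {B : Finset ℝ} (hB : B.Nonempty) :
    lineDistortion B = (lineDistortion (expand 0 B) + lineDistortion (expand 1 B)) / 18 := by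
  rw [lineDistortion, integral_selfSimilar (integrable_of_continuous (continuous_infDist_sq B))]
  simp only [infDist_T _ hB, div_pow, integral_div, lineDistortion]
  ring

lemma lineDistortion_anti {A B : Finset ℝ} (hA : A.Nonempty) (h : A ⊆ B) :
    lineDistortion B ≤ lineDistortion A :=
  integral_mono_Icc (continuous_infDist_sq B) (continuous_infDist_sq A) fun x _ _ => by
    have := Metric.infDist_le_infDist_of_subset (x := x) (Finset.coe_subset.mpr h)
      (by simpa using hA)
    exact pow_le_pow_left₀ Metric.infDist_nonneg this 2

lemma lineDistortion_singleton (b : ℝ) : lineDistortion {b} = 1 / 8 + (b - 1 / 2) ^ 2 := by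
  have h : ∀ x : ℝ, Metric.infDist x (({b} : Finset ℝ) : Set ℝ) ^ 2
      = 1 * x ^ 2 + (-2 * b) * x + b ^ 2 := fun x => by
    rw [Finset.coe_singleton, Metric.infDist_singleton, Real.dist_eq, sq_abs]; ring
  simp_rw [lineDistortion, h, integral_quadratic]
  ring

/-- Certifies numerical lower bounds: a quadratic lying below all `(x - y)^2` on `[0, 1]` is
integrated using only the first two moments. -/
lemma le_lineDistortion (a b c : ℝ) {B : Finset ℝ} (hB : B.Nonempty)
    (h : ∀ x, 0 ≤ x → x ≤ 1 → ∀ y ∈ B, a * x ^ 2 + b * x + c ≤ (x - y) ^ 2) :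
    a * (3 / 8) + b / 2 + c ≤ lineDistortion B := by
  rw [← integral_quadratic]
  refine integral_mono_Icc (by fun_prop) (continuous_infDist_sq B) fun x h0 h1 => ?_
  obtain ⟨y, hy, e⟩ := exists_infDist_eq hB x
  rw [e, sq_abs]
  exact h x h0 h1 y hy

/-- A sharper certificate, with one quadratic for each third; nothing is required over the middle
gap, which has no mass. -/
lemma le_lineDistortion_halves (a b c a' b' c' : ℝ) {B : Finset ℝ} (hB : B.Nonempty)
    (h : ∀ x, 0 ≤ x → x ≤ 1 → ∀ y ∈ B, a * x ^ 2 + b * x + c ≤ (x / 3 - y) ^ 2)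
    (h' : ∀ x, 0 ≤ x → x ≤ 1 → ∀ y ∈ B, a' * x ^ 2 + b' * x + c' ≤ (x / 3 + 2 / 3 - y) ^ 2) :
    (a * (3 / 8) + b / 2 + c + (a' * (3 / 8) + b' / 2 + c')) / 2 ≤ lineDistortion B := by
  have h0 : 9 * a * (3 / 8) + 9 * b / 2 + 9 * c ≤ lineDistortion (expand 0 B) := by
    refine le_lineDistortion _ _ _ (expand_nonempty hB) fun x h0 h1 y hy => ?_
    have := h x h0 h1 _ (mem_expand.mp hy)
    rw [T_zero] at this
    linarith
  have h1 : 9 * a' * (3 / 8) + 9 * b' / 2 + 9 * c' ≤ lineDistortion (expand 1 B) := by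
    refine le_lineDistortion _ _ _ (expand_nonempty hB) fun x h0 h1 y hy => ?_
    have := h' x h0 h1 _ (mem_expand.mp hy)
    rw [T_one] at this
    linarith
  rw [lineDistortion_eq hB]
  linarith

/-! ### Configurations with a point serving both halves -/

/-- The linear functions of `n` whose upper envelope is the quantization error of the Cantor
distribution on the line. -/
def envelope (ℓ : ℕ) (n : ℝ) : ℝ := (17 * 2 ^ ℓ - 8 * n) / (72 * 18 ^ ℓ)

/-- The same recursion as `lineDistortion_eq`, with sizes added; this is what drives the induction.
-/
lemma envelope_succ (ℓ : ℕ) (m n : ℝ) :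
    envelope (ℓ + 1) (m + n) = (envelope ℓ m + envelope ℓ n) / 18 := by
  simp only [envelope, pow_succ]; field_simp; ring

lemma envelope_strictAnti (ℓ : ℕ) : StrictAnti (envelope ℓ) := fun m n h => by
  unfold envelope; gcongr

/-- The value at `n = 0` decreases with the level. Past levels `0` and `1` this crude bound settles
the comparisons below; those two levels are checked by hand. -/
lemma envelope_add_two_le (ℓ : ℕ) {n : ℝ} (hn : 0 ≤ n) : envelope (ℓ + 2) n ≤ 17 / 5832 := by
  have h9 : (1 : ℝ) ≤ 9 ^ ℓ := one_le_pow₀ (by norm_num)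
  have h2 : (1 : ℝ) ≤ 2 ^ ℓ := one_le_pow₀ (by norm_num)
  have h18 : (18 : ℝ) ^ ℓ = 9 ^ ℓ * 2 ^ ℓ := by rw [← mul_pow]; norm_num
  rw [envelope, pow_add, pow_add, h18, div_le_div_iff₀ (by positivity) (by norm_num)]
  nlinarith

lemma envelope_le {ℓ : ℕ} {n : ℝ} (hn : 2 ≤ n) : envelope ℓ n ≤ 1 / 72 := by
  match ℓ with
  | 0 => simp only [envelope]; norm_num; linarith
  | 1 => simp only [envelope]; norm_num; linarith
  | ℓ + 2 => linarith [envelope_add_two_le ℓ (n := n) (by linarith)]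

lemma envelope_le_of_three_le {ℓ : ℕ} {n : ℝ} (hn : 3 ≤ n) : envelope ℓ n ≤ 10 / 1296 := by
  match ℓ with
  | 0 => simp only [envelope]; norm_num; linarith
  | 1 => simp only [envelope]; norm_num; linarith
  | ℓ + 2 => linarith [envelope_add_two_le ℓ (n := n) (by linarith)]

lemma envelope_lt_of_four_le {ℓ : ℕ} {n : ℝ} (hn : 4 ≤ n) : envelope ℓ n < 1 / 288 := by
  match ℓ with
  | 0 => simp only [envelope]; norm_num; linarith
  | 1 => simp only [envelope]; norm_num; linarith
  | ℓ + 2 => linarith [envelope_add_two_le ℓ (n := n) (by linarith)]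

lemma envelope_succ_lt {ℓ : ℕ} {n : ℝ} (hn : 1 ≤ n) : envelope (ℓ + 1) n < 1 / 8 := by
  match ℓ with
  | 0 => simp only [envelope]; norm_num; linarith
  | ℓ + 1 => linarith [envelope_add_two_le ℓ (n := n) (by linarith)]

/-- The target is `5/36 = 18 * (10 / 1296)` for the sum of the errors of the two rescaled copies.
The minorants are squares of distances to the extreme permitted positions of the points, or
quadratics below two such squares at once. -/
lemma lt_lineDistortion_three {a c d : ℝ} (hc : 1 / 2 ≤ c) (hc' : c ≤ 2 / 3)
    (ha : a ≤ 2 / 3 - c) (hd : c ≤ d) : 10 / 1296 < lineDistortion {a, c, d} := by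
  have hB : ({a, c, d} : Finset ℝ).Nonempty := by simp
  have hm0 : ∀ {p : ℝ → Prop}, p (3 * a) → p (3 * c) → p (3 * d) →
      ∀ y ∈ expand 0 {a, c, d}, p y := by
    intro p h1 h2 h3 y hy
    simp only [expand, Finset.mem_image, Finset.mem_insert, Finset.mem_singleton] at hy
    obtain ⟨b, rfl | rfl | rfl, rfl⟩ := hy <;> simpa
  have hm1 : ∀ {p : ℝ → Prop}, p (3 * a - 2) → p (3 * c - 2) → p (3 * d - 2) →
      ∀ y ∈ expand 1 {a, c, d}, p y := by
    intro p h1 h2 h3 y hy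
    simp only [expand, Finset.mem_image, Finset.mem_insert, Finset.mem_singleton] at hy
    obtain ⟨b, rfl | rfl | rfl, rfl⟩ := hy <;> simpa
  have bound := fun u v w u' v' w' => le_lineDistortion_halves u v w u' v' w'
    (expand_nonempty (i := 0) hB)
  have bound' := fun u v w u' v' w' => le_lineDistortion_halves u v w u' v' w'
    (expand_nonempty (i := 1) hB)
  rw [lineDistortion_eq hB]
  -- For `c ≥ 5/9` the rescaled `a` is at most `1/3`, and the left copy alone gives `19/144` of the
  -- required `20/144`. Otherwise the bounds `1/12` and `1/18` add up to exactly `5/36`, so the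
  -- second must be strict.
  rcases le_total (5 / 9) c with h59 | h59
  · have hL := bound 0 0 0 (1 / 9) (2 / 9) (1 / 9)
      (fun x h0 h1 y _ => by nlinarith [sq_nonneg (x / 3 - y)])
      (fun x h0 h1 => hm0 (by nlinarith) (by nlinarith) (by nlinarith))
    have hR : 1 / 48 ≤ lineDistortion (expand 1 {a, c, d}) := by
      rcases le_total (2 / 3) (3 * d - 2) with h | h
      · have := bound' (1 / 9) 0 0 0 0 0
          (fun x h0 h1 => hm1 (by nlinarith) (by nlinarith) (by nlinarith))
          (fun x h0 h1 y _ => by nlinarith [sq_nonneg (x / 3 + 2 / 3 - y)])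
        linarith
      · have := bound' 0 0 0 (1 / 9) 0 0
          (fun x h0 h1 y _ => by nlinarith [sq_nonneg (x / 3 - y)])
          (fun x h0 h1 => hm1 (by nlinarith) (by nlinarith) (by nlinarith))
        linarith
    linarith
  · have hL : 1 / 12 ≤ lineDistortion (expand 0 {a, c, d}) := by
      rcases le_total (1 / 3) (3 * a) with h | h
      · have := bound (1 / 9) (-2 / 9) (1 / 9) (1 / 9) (1 / 9) (1 / 36)
          (fun x h0 h1 => hm0 (by nlinarith) (by nlinarith) (by nlinarith))
          (fun x h0 h1 => hm0 (by nlinarith) (by nlinarith) (by nlinarith))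
        linarith
      · have := bound 0 0 0 (1 / 36) (1 / 9) (1 / 9)
          (fun x h0 h1 y _ => by nlinarith [sq_nonneg (x / 3 - y)])
          (fun x h0 h1 => hm0 (by nlinarith) (by nlinarith) (by nlinarith))
        linarith
    have hR : 1 / 18 < lineDistortion (expand 1 {a, c, d}) := by
      rcases le_total (3 * d - 2) (1 / 2) with h | h
      · have := bound' 0 0 0 (1 / 9) (1 / 9) (1 / 36)
          (fun x h0 h1 y _ => by nlinarith [sq_nonneg (x / 3 - y)])
          (fun x h0 h1 => hm1 (by nlinarith) (by nlinarith) (by nlinarith))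
        linarith
      · rcases le_total (3 * d - 2) (5 / 8) with h' | h'
        · have := bound' (1 / 36) (-1 / 9) (1 / 9) (1 / 9) (1 / 36) (1 / 576)
            (fun x h0 h1 => hm1 (by nlinarith) (by nlinarith) (by nlinarith))
            (fun x h0 h1 => hm1 (by nlinarith) (by nlinarith) (by nlinarith))
          linarith
        -- This concave quadratic is `(1/3)^2` at `x = 0` and `(5/8 - 1/3)^2` at `x = 1`, the
        -- squared distances to `-1/3` and to `5/8` at the two ends of the left third.
        · have := bound' (-79 / 576) (1 / 9) (1 / 9) 0 0 0
            (fun x h0 h1 => hm1 (by nlinarith) (by nlinarith) (by nlinarith))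
            (fun x h0 h1 y _ => by nlinarith [sq_nonneg (x / 3 + 2 / 3 - y)])
          linarith
    linarith

/-- The hypothesis on `B` is what remains of `c` being nearest to a point of the left third: a hole
between `2/3 - c` and `c`. Unless `B` has points on both sides of `c` and `c < 2/3`, one third is
served too badly even for two points; otherwise `B` contains a triple `a < c < d`, and is either
that triple or has at least four points. -/
lemma envelope_lt_lineDistortion (ℓ : ℕ) {B : Finset ℝ} {c : ℝ} (hcard : 2 ≤ B.card) (hcB : c ∈ B)
    (hc : 1 / 2 ≤ c) (h : ∀ b ∈ B, b ≤ 2 / 3 - c ∨ c ≤ b) :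
    envelope ℓ B.card < lineDistortion B := by
  have hB : B.Nonempty := ⟨c, hcB⟩
  have hcard' : (2 : ℝ) ≤ B.card := by exact_mod_cast hcard
  have hD := lineDistortion_eq hB
  have hL := lineDistortion_nonneg (expand 0 B)
  have hR := lineDistortion_nonneg (expand 1 B)
  have hm0 : ∀ {y : ℝ}, y ∈ expand 0 B → y ≤ 2 - 3 * c ∨ 3 * c ≤ y := by
    intro y hy
    have := h _ (mem_expand.mp hy)
    rw [T_zero] at this
    exact this.imp (by intro; linarith) (by intro; linarith)
  rcases le_total (2 / 3) c with hc2 | hc2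
  · have := le_lineDistortion 1 0 0 (expand_nonempty (i := 0) hB) fun x h0 h1 y hy => by
      rcases hm0 hy with hy | hy <;> nlinarith
    linarith [envelope_le (ℓ := ℓ) hcard']
  by_cases hd : ∀ b ∈ B, b ≤ c
  · have := le_lineDistortion 1 0 0 (expand_nonempty (i := 1) hB) fun x h0 h1 y hy => by
      have := hd _ (mem_expand.mp hy)
      rw [T_one] at this
      nlinarith
    linarith [envelope_le (ℓ := ℓ) hcard']
  by_cases ha : ∀ b ∈ B, c ≤ b
  · have := le_lineDistortion 1 (-3) (9 / 4) (expand_nonempty (i := 0) hB) fun x h0 h1 y hy => by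
      have := ha _ (mem_expand.mp hy)
      rw [T_zero] at this
      nlinarith
    linarith [envelope_le (ℓ := ℓ) hcard']
  push Not at hd ha
  obtain ⟨d, hdB, hd⟩ := hd
  obtain ⟨a, haB, hac⟩ := ha
  have ha : a ≤ 2 / 3 - c := (h a haB).resolve_right hac.not_ge
  have hsub : {a, c, d} ⊆ B := by
    intro y hy
    simp only [Finset.mem_insert, Finset.mem_singleton] at hy
    rcases hy with rfl | rfl | rfl <;> assumption
  have h3 : ({a, c, d} : Finset ℝ).card = 3 :=
    Finset.card_eq_three.mpr ⟨a, c, d, hac.ne, (hac.trans hd).ne, hd.ne, rfl⟩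
  have hle := Finset.card_le_card hsub
  rw [h3] at hle
  rcases hle.eq_or_lt with h4 | h4
  · have hBe : {a, c, d} = B := Finset.eq_of_subset_of_card_le hsub (by omega)
    have := lt_lineDistortion_three hc hc2 ha hd.le
    rw [hBe] at this
    have hcard3 : (3 : ℝ) ≤ B.card := by exact_mod_cast hle
    linarith [envelope_le_of_three_le (ℓ := ℓ) hcard3]
  -- With four or more points the hole alone suffices: the rescaled left copy avoids the interval
  -- from `1/2` to `3/2`, so its error is at least `1/16 = 18/288`.
  · have hcard4 : (4 : ℝ) ≤ B.card := by exact_mod_cast h4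
    have := le_lineDistortion_halves 0 0 0 (1 / 9) (1 / 9) (1 / 36) (expand_nonempty (i := 0) hB)
      (fun x h0 h1 y _ => by nlinarith [sq_nonneg (x / 3 - y)])
      (fun x h0 h1 y hy => by rcases hm0 hy with hy | hy <;> nlinarith)
    linarith [envelope_lt_of_four_le (ℓ := ℓ) hcard4]

lemma lineDistortion_reflect {B : Finset ℝ} (hB : B.Nonempty) :
    lineDistortion (B.image fun b => 1 - b) = lineDistortion B := by
  rw [lineDistortion, ← integral_reflect, lineDistortion]
  congr 1
  funext x
  congr 1
  have key : ∀ b : ℝ, |1 - x - (1 - b)| = |x - b| := fun b => by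
    rw [← abs_neg]; congr 1; ring
  apply le_antisymm
  · obtain ⟨b, hb, h⟩ := exists_infDist_eq hB x
    rw [h, ← key]
    exact infDist_le_abs (Finset.mem_image_of_mem _ hb) _
  · obtain ⟨y, hy, h⟩ := exists_infDist_eq (hB.image fun b => 1 - b) (1 - x)
    obtain ⟨b, hb, rfl⟩ := Finset.mem_image.mp hy
    rw [h, key]
    exact infDist_le_abs hb x

/-! ### Sharing the points of a set between the two thirds -/

open Classical in
/-- The points of `B` that are nearest in `B` to some point of the basic interval `T i [0, 1]`. -/
def servers (i : Fin 2) (B : Finset ℝ) : Finset ℝ :=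
  B.filter fun b => ∃ x ∈ Set.Icc (0 : ℝ) 1, |T i x - b| = Metric.infDist (T i x) (B : Set ℝ)

lemma mem_servers {i : Fin 2} {B : Finset ℝ} {b : ℝ} : b ∈ servers i B ↔
    b ∈ B ∧ ∃ x ∈ Set.Icc (0 : ℝ) 1, |T i x - b| = Metric.infDist (T i x) (B : Set ℝ) := by
  simp only [servers, Finset.mem_filter]

lemma servers_subset (i : Fin 2) (B : Finset ℝ) : servers i B ⊆ B :=
  fun _ hb => (mem_servers.mp hb).1

lemma exists_servers_infDist_eq (i : Fin 2) {B : Finset ℝ} (hB : B.Nonempty) {x : ℝ}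
    (hx : x ∈ Set.Icc (0 : ℝ) 1) :
    ∃ b ∈ servers i B, Metric.infDist (T i x) (B : Set ℝ) = |T i x - b| := by
  obtain ⟨b, hb, h⟩ := exists_infDist_eq hB (T i x)
  exact ⟨b, mem_servers.mpr ⟨hb, x, hx, h.symm⟩, h⟩

lemma servers_nonempty (i : Fin 2) {B : Finset ℝ} (hB : B.Nonempty) : (servers i B).Nonempty := by
  obtain ⟨b, hb, -⟩ := exists_servers_infDist_eq i hB (x := 0) (by simp)
  exact ⟨b, hb⟩

lemma lineDistortion_expand_servers (i : Fin 2) {B : Finset ℝ} (hB : B.Nonempty) :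
    lineDistortion (expand i (servers i B)) = lineDistortion (expand i B) := by
  refine integral_congr_Icc fun x h0 h1 => ?_
  have hS := servers_nonempty i hB
  congr 1
  have e1 := infDist_T i hB x
  have e2 := infDist_T i hS x
  suffices Metric.infDist (T i x) (servers i B : Set ℝ) = Metric.infDist (T i x) (B : Set ℝ) by
    linarith
  apply le_antisymm
  · obtain ⟨b, hb, h⟩ := exists_servers_infDist_eq i hB ⟨h0, h1⟩
    rw [h]
    exact infDist_le_abs hb _
  · exact Metric.infDist_le_infDist_of_subset (Finset.coe_subset.mpr (servers_subset i B))
      (by simpa using hS)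

lemma envelope_lt_of_not_disjoint (ℓ : ℕ) {B : Finset ℝ} (hcard : 2 ≤ B.card)
    (h : ¬ Disjoint (servers 0 B) (servers 1 B)) : envelope ℓ B.card < lineDistortion B := by
  obtain ⟨c, hc0, hc1⟩ := Finset.not_disjoint_iff.mp h
  obtain ⟨hcB, x, ⟨hx0, hx1⟩, hx⟩ := mem_servers.mp hc0
  obtain ⟨-, y, ⟨hy0, hy1⟩, hy⟩ := mem_servers.mp hc1
  rw [T_zero] at hx
  rw [T_one] at hy
  rcases le_total (1 / 2) c with hc | hc
  -- A point strictly between `2/3 - c` and `c` would be closer than `c` to `x/3 ≤ 1/3`. The case `c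
  -- ≤ 1/2` is the mirror image, using the point of the right third.
  · refine envelope_lt_lineDistortion ℓ hcard hcB hc fun b hb => ?_
    by_contra! hb'
    have := infDist_le_abs hb (x / 3)
    rw [← hx, abs_of_nonpos (by linarith)] at this
    rcases le_abs.mp this with h | h <;> linarith
  · have hinj : Function.Injective fun b : ℝ => 1 - b := fun a b h => by simpa using h
    rw [← lineDistortion_reflect ⟨c, hcB⟩, ← Finset.card_image_of_injective B hinj]
    refine envelope_lt_lineDistortion ℓ (c := 1 - c) (by rwa [Finset.card_image_of_injective _ hinj])
      (Finset.mem_image_of_mem _ hcB) (by linarith) fun b' hb' => ?_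
    obtain ⟨b, hb, rfl⟩ := Finset.mem_image.mp hb'
    by_contra! hb'
    have := infDist_le_abs hb (y / 3 + 2 / 3)
    rw [← hy, abs_of_nonneg (by linarith)] at this
    rcases le_abs.mp this with h | h <;> linarith

/-- Points serving neither third may be dropped, so sizes only satisfy an inequality; when it is an
equality nothing was dropped and `B` is recovered from its parts. -/
lemma exists_split_of_disjoint {B : Finset ℝ} (hB : B.Nonempty)
    (h : Disjoint (servers 0 B) (servers 1 B)) :
    ∃ B₀ B₁ : Finset ℝ, B₀.Nonempty ∧ B₁.Nonempty ∧ B₀.card + B₁.card ≤ B.card ∧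
      lineDistortion B = (lineDistortion B₀ + lineDistortion B₁) / 18 ∧
      (B₀.card + B₁.card = B.card → (B : Set ℝ) = T 0 '' B₀ ∪ T 1 '' B₁) := by
  have hsub := Finset.union_subset (servers_subset 0 B) (servers_subset 1 B)
  have hle := Finset.card_le_card hsub
  rw [Finset.card_union_of_disjoint h] at hle
  refine ⟨expand 0 (servers 0 B), expand 1 (servers 1 B), expand_nonempty (servers_nonempty 0 hB),
    expand_nonempty (servers_nonempty 1 hB), by simpa only [card_expand] using hle, ?_, ?_⟩
  · rw [lineDistortion_expand_servers 0 hB, lineDistortion_expand_servers 1 hB, lineDistortion_eq hB]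
  · intro hcard
    simp only [card_expand] at hcard
    rw [T_image_expand, T_image_expand, ← Finset.coe_union, Finset.coe_inj]
    exact (Finset.eq_of_subset_of_card_le hsub
      (by rw [Finset.card_union_of_disjoint h, hcard])).symm

/-! ### Optimal sets on the line -/

/-- The first coordinates of the points of `alphaSet`. -/
def betaSet (ℓ : ℕ) (I : Finset (List (Fin 2))) : Set ℝ :=
  {x | ∃ σ : List (Fin 2), σ.length = ℓ ∧ σ ∉ I ∧ x = Tword σ (1 / 2)} ∪
  {x | ∃ σ ∈ I, x = Tword (σ ++ [0]) (1 / 2)} ∪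
  {x | ∃ σ ∈ I, x = Tword (σ ++ [1]) (1 / 2)}

/-- The words that begin with `0` and continue in `I₀`, or begin with `1` and continue in `I₁`. -/
def joinWords (I₀ I₁ : Finset (List (Fin 2))) : Finset (List (Fin 2)) :=
  I₀.image (List.cons 0) ∪ I₁.image (List.cons 1)

lemma zero_cons_mem_joinWords {I₀ I₁ : Finset (List (Fin 2))} {σ : List (Fin 2)} :
    0 :: σ ∈ joinWords I₀ I₁ ↔ σ ∈ I₀ := by simp [joinWords]

lemma one_cons_mem_joinWords {I₀ I₁ : Finset (List (Fin 2))} {σ : List (Fin 2)} :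
    1 :: σ ∈ joinWords I₀ I₁ ↔ σ ∈ I₁ := by simp [joinWords]

lemma nil_notMem_joinWords {I₀ I₁ : Finset (List (Fin 2))} : [] ∉ joinWords I₀ I₁ := by
  simp [joinWords]

lemma card_joinWords (I₀ I₁ : Finset (List (Fin 2))) :
    (joinWords I₀ I₁).card = I₀.card + I₁.card := by
  rw [joinWords, Finset.card_union_of_disjoint,
    Finset.card_image_of_injective _ (List.cons_injective),
    Finset.card_image_of_injective _ (List.cons_injective)]
  rw [Finset.disjoint_left]
  intro σ h0 h1
  obtain ⟨τ, -, rfl⟩ := Finset.mem_image.mp h0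
  simp at h1

lemma exists_joinWords {ℓ : ℕ} {I : Finset (List (Fin 2))} (hI : ∀ σ ∈ I, σ.length = ℓ + 1) :
    ∃ I₀ I₁, (∀ σ ∈ I₀, σ.length = ℓ) ∧ (∀ σ ∈ I₁, σ.length = ℓ) ∧ I = joinWords I₀ I₁ := by
  refine ⟨I.preimage (List.cons 0) (List.cons_injective.injOn),
    I.preimage (List.cons 1) (List.cons_injective.injOn), fun σ hσ => ?_, fun σ hσ => ?_, ?_⟩
  · simpa using hI _ (Finset.mem_preimage.mp hσ)
  · simpa using hI _ (Finset.mem_preimage.mp hσ)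
  · ext σ
    match σ with
    | [] => exact iff_of_false (fun h => by simpa using hI _ h) nil_notMem_joinWords
    | 0 :: σ => rw [zero_cons_mem_joinWords, Finset.mem_preimage]
    | 1 :: σ => rw [one_cons_mem_joinWords, Finset.mem_preimage]

/-- Sorting words by first letter: the extremal sets obey the same decomposition as the sets `B` in
the induction. -/
lemma betaSet_succ (ℓ : ℕ) (I₀ I₁ : Finset (List (Fin 2))) :
    betaSet (ℓ + 1) (joinWords I₀ I₁) = T 0 '' betaSet ℓ I₀ ∪ T 1 '' betaSet ℓ I₁ := by
  ext x
  constructor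
  · rintro ((⟨σ, hσ, hI, rfl⟩ | ⟨σ, hI, rfl⟩) | ⟨σ, hI, rfl⟩)
    · match σ with
      | [] => simp at hσ
      | 0 :: σ =>
        exact .inl ⟨_, .inl (.inl ⟨σ, by simpa using hσ, mt zero_cons_mem_joinWords.mpr hI, rfl⟩), rfl⟩
      | 1 :: σ =>
        exact .inr ⟨_, .inl (.inl ⟨σ, by simpa using hσ, mt one_cons_mem_joinWords.mpr hI, rfl⟩), rfl⟩
    · match σ with
      | [] => exact absurd hI nil_notMem_joinWords
      | 0 :: σ => exact .inl ⟨_, .inl (.inr ⟨σ, zero_cons_mem_joinWords.mp hI, rfl⟩), rfl⟩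
      | 1 :: σ => exact .inr ⟨_, .inl (.inr ⟨σ, one_cons_mem_joinWords.mp hI, rfl⟩), rfl⟩
    · match σ with
      | [] => exact absurd hI nil_notMem_joinWords
      | 0 :: σ => exact .inl ⟨_, .inr ⟨σ, zero_cons_mem_joinWords.mp hI, rfl⟩, rfl⟩
      | 1 :: σ => exact .inr ⟨_, .inr ⟨σ, one_cons_mem_joinWords.mp hI, rfl⟩, rfl⟩
  · rintro (⟨_, (⟨σ, hσ, hI, rfl⟩ | ⟨σ, hI, rfl⟩) | ⟨σ, hI, rfl⟩, rfl⟩ |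
      ⟨_, (⟨σ, hσ, hI, rfl⟩ | ⟨σ, hI, rfl⟩) | ⟨σ, hI, rfl⟩, rfl⟩)
    · exact .inl (.inl ⟨0 :: σ, by simpa using hσ, mt zero_cons_mem_joinWords.mp hI, rfl⟩)
    · exact .inl (.inr ⟨0 :: σ, zero_cons_mem_joinWords.mpr hI, rfl⟩)
    · exact .inr ⟨0 :: σ, zero_cons_mem_joinWords.mpr hI, rfl⟩
    · exact .inl (.inl ⟨1 :: σ, by simpa using hσ, mt one_cons_mem_joinWords.mp hI, rfl⟩)
    · exact .inl (.inr ⟨1 :: σ, one_cons_mem_joinWords.mpr hI, rfl⟩)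
    · exact .inr ⟨1 :: σ, one_cons_mem_joinWords.mpr hI, rfl⟩

lemma betaSet_zero_empty : betaSet 0 ∅ = {1 / 2} := by
  ext x
  simp [betaSet, List.length_eq_zero_iff, Tword]

lemma betaSet_zero_nil : betaSet 0 {[]} = {1 / 6, 5 / 6} := by
  ext x
  simp only [betaSet, List.length_eq_zero_iff, Set.mem_union, Set.mem_ofPred_eq,
    Finset.mem_singleton, exists_eq_left, not_true_eq_false, false_and, false_or,
    List.nil_append, Tword, Function.comp, id, T_zero, T_one, Set.mem_insert_iff,
    Set.mem_singleton_iff]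
  norm_num

lemma words_zero {I : Finset (List (Fin 2))} (hI : ∀ σ ∈ I, σ.length = 0) :
    I = ∅ ∨ I = {[]} :=
  Finset.subset_singleton_iff.mp fun σ hσ => by
    simpa using List.length_eq_zero_iff.mp (hI σ hσ)

lemma eighth_le_lineDistortion {B : Finset ℝ} (hB : B.card = 1) :
    1 / 8 ≤ lineDistortion B ∧ (lineDistortion B = 1 / 8 → B = {1 / 2}) := by
  obtain ⟨b, rfl⟩ := Finset.card_eq_one.mp hB
  rw [lineDistortion_singleton]
  refine ⟨by nlinarith, fun h => ?_⟩
  have : (b - 1 / 2) ^ 2 = 0 := by linarith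
  rw [sub_eq_zero.mp (pow_eq_zero_iff (two_ne_zero)|>.mp this)]

theorem envelope_le_lineDistortion (ℓ : ℕ) {B : Finset ℝ} (hB : B.Nonempty) :
    envelope ℓ B.card ≤ lineDistortion B ∧ (lineDistortion B = envelope ℓ B.card →
      ∃ I : Finset (List (Fin 2)), (∀ σ ∈ I, σ.length = ℓ) ∧ B.card = 2 ^ ℓ + I.card ∧
        (B : Set ℝ) = betaSet ℓ I) := by
  have hpos := hB.card_pos
  induction ℓ generalizing B with
  | zero =>
    rcases (show B.card = 1 ∨ B.card = 2 ∨ 3 ≤ B.card by omega) with h1 | h2 | h3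
    · obtain ⟨hle, heq⟩ := eighth_le_lineDistortion h1
      have he : envelope 0 (B.card : ℝ) = 1 / 8 := by rw [h1]; norm_num [envelope]
      rw [he]
      refine ⟨hle, fun h => ⟨∅, by simp, by simpa using h1, ?_⟩⟩
      rw [heq h, betaSet_zero_empty, Finset.coe_singleton]
    · by_cases hdis : Disjoint (servers 0 B) (servers 1 B)
      · obtain ⟨B₀, B₁, hB₀, hB₁, hcard, hD, hB'⟩ := exists_split_of_disjoint hB hdis
        have hp₀ := hB₀.card_pos
        have hp₁ := hB₁.card_pos
        obtain ⟨hle₀, heq₀⟩ := eighth_le_lineDistortion (show B₀.card = 1 by omega)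
        obtain ⟨hle₁, heq₁⟩ := eighth_le_lineDistortion (show B₁.card = 1 by omega)
        have he : envelope 0 (B.card : ℝ) = 1 / 72 := by rw [h2]; norm_num [envelope]
        rw [he]
        refine ⟨by linarith, fun h => ⟨{[]}, by simp, by simpa using h2, ?_⟩⟩
        rw [hB' (by omega), heq₀ (by linarith), heq₁ (by linarith), betaSet_zero_nil]
        simp only [Finset.coe_singleton, Set.image_singleton, T_zero, T_one,
          Set.singleton_union]
        norm_num
      · have := envelope_lt_of_not_disjoint 0 (by omega) hdis
        exact ⟨this.le, fun h => absurd h this.ne'⟩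
    -- Three points are too many for level `0`: the line `envelope 0` is already negative there.
    · have h3' : (3 : ℝ) ≤ B.card := by exact_mod_cast h3
      have : envelope 0 (B.card : ℝ) < 0 := by
        simp only [envelope]
        exact div_neg_of_neg_of_pos (by linarith) (by norm_num)
      have := this.trans_le (lineDistortion_nonneg B)
      exact ⟨this.le, fun h => absurd h this.ne'⟩
  | succ ℓ ih =>
    rcases (show B.card = 1 ∨ 2 ≤ B.card by omega) with h1 | h2
    · have := (envelope_succ_lt (ℓ := ℓ) (n := B.card) (by rw [h1]; norm_num)).trans_le
        (eighth_le_lineDistortion h1).1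
      exact ⟨this.le, fun h => absurd h this.ne'⟩
    by_cases hdis : Disjoint (servers 0 B) (servers 1 B)
    · obtain ⟨B₀, B₁, hB₀, hB₁, hcard, hD, hB'⟩ := exists_split_of_disjoint hB hdis
      obtain ⟨hle₀, heq₀⟩ := ih hB₀ hB₀.card_pos
      obtain ⟨hle₁, heq₁⟩ := ih hB₁ hB₁.card_pos
      have hadd := envelope_succ ℓ B₀.card B₁.card
      have hcard' : (B₀.card + B₁.card : ℝ) ≤ B.card := by exact_mod_cast hcard
      have hanti := (envelope_strictAnti (ℓ + 1)).antitone hcard'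
      refine ⟨by linarith, fun h => ?_⟩
      -- Equality overall squeezes the chain of inequalities; injectivity of `envelope (ℓ + 1)` then
      -- says that no point was dropped.
      have hcard'' : (B₀.card + B₁.card : ℝ) = B.card :=
        (envelope_strictAnti (ℓ + 1)).injective (by linarith)
      have hsum : B₀.card + B₁.card = B.card := by exact_mod_cast hcard''
      obtain ⟨I₀, hI₀, hc₀, hs₀⟩ := heq₀ (by linarith)
      obtain ⟨I₁, hI₁, hc₁, hs₁⟩ := heq₁ (by linarith)
      refine ⟨joinWords I₀ I₁, fun σ hσ => ?_, ?_, ?_⟩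
      · rcases Finset.mem_union.mp hσ with hσ | hσ
        · obtain ⟨τ, hτ, rfl⟩ := Finset.mem_image.mp hσ
          simpa using hI₀ τ hτ
        · obtain ⟨τ, hτ, rfl⟩ := Finset.mem_image.mp hσ
          simpa using hI₁ τ hτ
      · rw [card_joinWords, pow_succ]
        omega
      · rw [betaSet_succ, ← hs₀, ← hs₁, hB' hsum]
    · have := envelope_lt_of_not_disjoint (ℓ + 1) h2 hdis
      exact ⟨this.le, fun h => absurd h this.ne'⟩

/-- Only upper bounds on size and error are proved, so the points need not be shown distinct, nor
their nearest-point regions computed: letting each part serve its own third already gives the bound,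
and `envelope_le_lineDistortion` supplies the reverse inequality. -/
lemma exists_finset_eq_betaSet {ℓ : ℕ} {I : Finset (List (Fin 2))}
    (hI : ∀ σ ∈ I, σ.length = ℓ) :
    ∃ B : Finset ℝ, (B : Set ℝ) = betaSet ℓ I ∧ B.Nonempty ∧ B.card ≤ 2 ^ ℓ + I.card ∧
      (B : Set ℝ) ⊆ Set.Icc 0 1 ∧ lineDistortion B ≤ envelope ℓ (2 ^ ℓ + I.card) := by
  induction ℓ generalizing I with
  | zero =>
    rcases words_zero hI with rfl | rfl
    · refine ⟨{1 / 2}, by rw [betaSet_zero_empty]; simp, by simp, by simp, ?_, ?_⟩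
      · simp; norm_num
      · rw [lineDistortion_singleton]; norm_num [envelope]
    · refine ⟨{1 / 6, 5 / 6}, by rw [betaSet_zero_nil]; simp, by simp, Finset.card_le_two, ?_, ?_⟩
      · intro x hx
        simp only [Finset.coe_insert, Finset.coe_singleton, Set.mem_insert_iff,
          Set.mem_singleton_iff] at hx
        rcases hx with rfl | rfl <;> norm_num
      · have h0 : lineDistortion (expand 0 {1 / 6, 5 / 6}) ≤ 1 / 8 := by
          refine (lineDistortion_anti (A := {1 / 2}) (by simp) ?_).trans
            (by rw [lineDistortion_singleton]; norm_num)
          rw [Finset.singleton_subset_iff, mem_expand, T_zero]; norm_num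
        have h1 : lineDistortion (expand 1 {1 / 6, 5 / 6}) ≤ 1 / 8 := by
          refine (lineDistortion_anti (A := {1 / 2}) (by simp) ?_).trans
            (by rw [lineDistortion_singleton]; norm_num)
          rw [Finset.singleton_subset_iff, mem_expand, T_one]; norm_num
        rw [lineDistortion_eq (by simp)]
        norm_num [envelope] at h0 h1 ⊢
        linarith
  | succ ℓ ih =>
    obtain ⟨I₀, I₁, hI₀, hI₁, rfl⟩ := exists_joinWords hI
    obtain ⟨B₀, hs₀, hn₀, hc₀, hu₀, hD₀⟩ := ih hI₀
    obtain ⟨B₁, hs₁, hn₁, hc₁, hu₁, hD₁⟩ := ih hI₁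
    have hB : (B₀.image (T 0) ∪ B₁.image (T 1)).Nonempty :=
      (hn₀.image _).mono Finset.subset_union_left
    refine ⟨B₀.image (T 0) ∪ B₁.image (T 1), ?_, hB, ?_, ?_, ?_⟩
    · rw [betaSet_succ, ← hs₀, ← hs₁]
      push_cast; rfl
    · have := Finset.card_union_le (B₀.image (T 0)) (B₁.image (T 1))
      have h0 := Finset.card_image_le (s := B₀) (f := T 0)
      have h1 := Finset.card_image_le (s := B₁) (f := T 1)
      rw [card_joinWords, pow_succ]
      omega
    · intro x hx
      rcases Finset.mem_union.mp (Finset.mem_coe.mp hx) with hx | hx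
      · obtain ⟨y, hy, rfl⟩ := Finset.mem_image.mp hx
        exact T_mem_Icc (hu₀ hy)
      · obtain ⟨y, hy, rfl⟩ := Finset.mem_image.mp hx
        exact T_mem_Icc (hu₁ hy)
    · have h0 : lineDistortion (expand 0 (B₀.image (T 0) ∪ B₁.image (T 1))) ≤ lineDistortion B₀ :=
        lineDistortion_anti hn₀ fun y hy => mem_expand.mpr
          (Finset.mem_union_left _ (Finset.mem_image_of_mem _ hy))
      have h1 : lineDistortion (expand 1 (B₀.image (T 0) ∪ B₁.image (T 1))) ≤ lineDistortion B₁ :=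
        lineDistortion_anti hn₁ fun y hy => mem_expand.mpr
          (Finset.mem_union_right _ (Finset.mem_image_of_mem _ hy))
      have he := envelope_succ ℓ (2 ^ ℓ + I₀.card) (2 ^ ℓ + I₁.card)
      have hr : (2 ^ (ℓ + 1) + ((joinWords I₀ I₁).card : ℝ))
          = 2 ^ ℓ + I₀.card + (2 ^ ℓ + I₁.card) := by
        rw [card_joinWords]; push_cast; ring
      rw [lineDistortion_eq hB, hr, he]
      linarith

/-! ### Distortion in the plane -/

/-- The embedding of the line as the first coordinate axis. -/
def axis (x : ℝ) : Plane := !₂[x, 0]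

lemma dist_axis_sq (x : ℝ) (p : Plane) : dist (axis x) p ^ 2 = (x - p 0) ^ 2 + p 1 ^ 2 := by
  rw [EuclideanSpace.dist_eq, Real.sq_sqrt (by positivity)]
  simp [axis, Fin.sum_univ_two, Real.dist_eq]

lemma continuous_axis : Continuous axis := by
  unfold axis; fun_prop

lemma injective_axis : Function.Injective axis := fun x y h => by
  simpa [axis] using congrArg (fun p : Plane => p 0) h

lemma iInf_dist_sq {A : Finset Plane} (hA : A.Nonempty) (x : Plane) :
    ⨅ a : (A : Set Plane), dist x (a : Plane) ^ 2 = Metric.infDist x (A : Set Plane) ^ 2 := by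
  have hA' : (A : Set Plane).Nonempty := by simpa using hA
  have : Nonempty (A : Set Plane) := hA'.to_subtype
  obtain ⟨p, hp, h⟩ := A.finite_toSet.isCompact.exists_infDist_eq_dist hA' x
  apply le_antisymm
  · rw [h]
    exact ciInf_le (f := fun a : (A : Set Plane) => dist x (a : Plane) ^ 2)
      ⟨0, by rintro _ ⟨a, rfl⟩; positivity⟩ ⟨p, hp⟩
  · exact le_ciInf fun a => pow_le_pow_left₀ Metric.infDist_nonneg
      (Metric.infDist_le_dist_of_mem a.2) 2

lemma distortion_planeCantor {A : Finset Plane} (hA : A.Nonempty) :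
    distortion planeCantor A = ∫ x, Metric.infDist (axis x) (A : Set Plane) ^ 2 ∂cantorMeasure := by
  simp_rw [distortion, iInf_dist_sq hA]
  exact (continuous_axis.measurableEmbedding injective_axis).integral_map _

/-- The first coordinates of a finite set of points. -/
def firstCoords (A : Finset Plane) : Finset ℝ := A.image fun p => p 0

lemma exists_infDist_axis {A : Finset Plane} (hA : A.Nonempty) (x : ℝ) :
    ∃ p ∈ A, Metric.infDist (axis x) (A : Set Plane) ^ 2 = (x - p 0) ^ 2 + p 1 ^ 2 := by
  obtain ⟨p, hp, h⟩ := A.finite_toSet.isCompact.exists_infDist_eq_dist (by simpa using hA) (axis x)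
  exact ⟨p, hp, by rw [h, dist_axis_sq]⟩

lemma infDist_firstCoords_sq_le {A : Finset Plane} {p : Plane} (hp : p ∈ A) (x : ℝ) :
    Metric.infDist x (firstCoords A : Set ℝ) ^ 2 ≤ (x - p 0) ^ 2 := by
  rw [← sq_abs (x - p 0)]
  exact pow_le_pow_left₀ Metric.infDist_nonneg (infDist_le_abs (Finset.mem_image_of_mem _ hp) x) 2

lemma infDist_firstCoords_add_le {A : Finset Plane} (hA : A.Nonempty) {h : ℝ} (h0 : 0 ≤ h)
    (hh : ∀ p ∈ A, h ≤ p 1) (x : ℝ) :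
    Metric.infDist x (firstCoords A : Set ℝ) ^ 2 + h ^ 2
      ≤ Metric.infDist (axis x) (A : Set Plane) ^ 2 := by
  obtain ⟨p, hp, e⟩ := exists_infDist_axis hA x
  rw [e]
  exact add_le_add (infDist_firstCoords_sq_le hp x) (pow_le_pow_left₀ h0 (hh p hp) 2)

lemma integral_infDist_add_const (B : Finset ℝ) (c : ℝ) :
    ∫ x, (Metric.infDist x (B : Set ℝ) ^ 2 + c) ∂cantorMeasure = lineDistortion B + c := by
  rw [integral_add (integrable_of_continuous (continuous_infDist_sq B)) (integrable_const _)]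
  simp [lineDistortion]

lemma integrable_infDist_axis_sq (A : Finset Plane) :
    Integrable (fun x => Metric.infDist (axis x) (A : Set Plane) ^ 2) cantorMeasure :=
  integrable_of_continuous (((Metric.continuous_infDist_pt _).comp continuous_axis).pow 2)

lemma integrable_infDist_add_const (B : Finset ℝ) (c : ℝ) :
    Integrable (fun x => Metric.infDist x (B : Set ℝ) ^ 2 + c) cantorMeasure :=
  integrable_of_continuous ((continuous_infDist_sq B).add continuous_const)

lemma lineDistortion_add_le_distortion {A : Finset Plane} (hA : A.Nonempty) {h : ℝ} (h0 : 0 ≤ h)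
    (hh : ∀ p ∈ A, h ≤ p 1) :
    lineDistortion (firstCoords A) + h ^ 2 ≤ distortion planeCantor A := by
  rw [distortion_planeCantor hA, ← integral_infDist_add_const]
  exact integral_mono (integrable_infDist_add_const _ _) (integrable_infDist_axis_sq A)
    (infDist_firstCoords_add_le hA h0 hh)

/-- Equality of the integrals is equality almost everywhere of the integrands, which forces the
nearest point to have height `h` and its first coordinate to be nearest too. Hence the points at
height `h` alone do as well on the line. -/
lemma exists_flat_subset {A : Finset Plane} (hA : A.Nonempty) {h : ℝ} (h0 : 0 ≤ h)
    (hh : ∀ p ∈ A, h ≤ p 1)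
    (heq : distortion planeCantor A = lineDistortion (firstCoords A) + h ^ 2) :
    ∃ A' ⊆ A, A'.Nonempty ∧ (∀ p ∈ A', p 1 = h) ∧
      lineDistortion (firstCoords A') ≤ lineDistortion (firstCoords A) := by
  rw [distortion_planeCantor hA, ← integral_infDist_add_const, eq_comm,
    integral_eq_iff_of_ae_le (integrable_infDist_add_const _ _) (integrable_infDist_axis_sq A)
    (Filter.Eventually.of_forall (infDist_firstCoords_add_le hA h0 hh))] at heq
  have key : ∀ᵐ x ∂cantorMeasure, ∃ p ∈ A.filter (fun p => p 1 = h),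
      (x - p 0) ^ 2 = Metric.infDist x (firstCoords A : Set ℝ) ^ 2 := by
    filter_upwards [heq] with x hx
    obtain ⟨p, hp, e⟩ := exists_infDist_axis hA x
    have h1 := infDist_firstCoords_sq_le hp x
    have h2 := hh p hp
    rw [e] at hx
    have h3 : p 1 = h := by nlinarith
    refine ⟨p, Finset.mem_filter.mpr ⟨hp, h3⟩, ?_⟩
    rw [h3] at hx
    linarith
  have hne : (A.filter fun p => p 1 = h).Nonempty := by
    obtain ⟨x, p, hp, -⟩ := key.exists
    exact ⟨p, hp⟩
  refine ⟨A.filter fun p => p 1 = h, Finset.filter_subset _ _, hne,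
    fun p hp => (Finset.mem_filter.mp hp).2, ?_⟩
  refine integral_mono_ae (integrable_of_continuous (continuous_infDist_sq _))
    (integrable_of_continuous (continuous_infDist_sq _)) ?_
  filter_upwards [key] with x hx
  obtain ⟨p, hp, e⟩ := hx
  exact (infDist_firstCoords_sq_le hp x).trans_eq e

lemma distortion_le_of_flat {A : Finset Plane} (hA : A.Nonempty) {h : ℝ}
    (hh : ∀ p ∈ A, p 1 = h) :
    distortion planeCantor A ≤ lineDistortion (firstCoords A) + h ^ 2 := by
  rw [distortion_planeCantor hA, ← integral_infDist_add_const]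
  refine integral_mono (integrable_infDist_axis_sq A) (integrable_infDist_add_const _ _) fun x => ?_
  obtain ⟨b, hb, e⟩ := exists_infDist_eq (hA.image fun p => p 0) x
  obtain ⟨p, hp, rfl⟩ := Finset.mem_image.mp hb
  change Metric.infDist x (firstCoords A : Set ℝ) = _ at e
  dsimp only
  rw [e, sq_abs, ← hh p hp, ← dist_axis_sq]
  exact pow_le_pow_left₀ Metric.infDist_nonneg (Metric.infDist_le_dist_of_mem hp) 2

/-! ### Constrained optimal sets -/

lemma alphaSet_eq (n ℓ : ℕ) (I : Finset (List (Fin 2))) :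
    alphaSet n ℓ I = (fun x : ℝ => (!₂[x, 1 + 1 / (n : ℝ)] : Plane)) '' betaSet ℓ I := by
  ext p
  simp only [alphaSet, betaSet, condMean_eq, Set.image_union]
  refine or_congr (or_congr ?_ ?_) ?_
  · constructor
    · rintro ⟨σ, h1, h2, rfl⟩
      exact ⟨_, ⟨σ, h1, h2, rfl⟩, rfl⟩
    · rintro ⟨_, ⟨σ, h1, h2, rfl⟩, rfl⟩
      exact ⟨σ, h1, h2, rfl⟩
  all_goals
    constructor
    · rintro ⟨σ, h1, rfl⟩
      exact ⟨_, ⟨σ, h1, rfl⟩, rfl⟩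
    · rintro ⟨_, ⟨σ, h1, rfl⟩, rfl⟩
      exact ⟨σ, h1, rfl⟩

lemma IsAdmissible.exists_finset {S : ℕ → Set Plane} {n : ℕ} {α : Set Plane}
    (h : IsAdmissible S n α) : ∃ A : Finset Plane, A.Nonempty ∧ A.card ≤ n ∧ α = A := by
  obtain ⟨-, h1, hn⟩ := h
  have hfin : α.Finite := Set.finite_of_encard_le_coe hn
  refine ⟨hfin.toFinset, ?_, ?_, by simp⟩
  · rw [Set.Finite.toFinset_nonempty]
    exact Set.one_le_encard_iff_nonempty.mp h1
  · rw [hfin.encard_eq_coe_toFinset_card] at hn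
    exact_mod_cast hn

lemma IsAdmissible.le_snd {n : ℕ} {α : Set Plane} (h : IsAdmissible constraintSet n α) {p : Plane}
    (hp : p ∈ α) : 1 + 1 / (n : ℝ) ≤ p 1 := by
  obtain ⟨j, hj, -, -, e⟩ := Set.mem_iUnion₂.mp (h.1 hp)
  rw [e]
  have h1 : (0 : ℝ) < j := by exact_mod_cast hj.1
  have h2 : (j : ℝ) ≤ n := by exact_mod_cast hj.2
  gcongr

lemma IsAdmissible.le_distortion {n : ℕ} (ℓ : ℕ) {α : Set Plane}
    (h : IsAdmissible constraintSet n α) :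
    envelope ℓ n + (1 + 1 / (n : ℝ)) ^ 2 ≤ distortion planeCantor α := by
  obtain ⟨A, hA, hcard, rfl⟩ := h.exists_finset
  have h1 := lineDistortion_add_le_distortion hA (by positivity) fun p hp => h.le_snd hp
  have h2 := (envelope_le_lineDistortion ℓ (hA.image fun p => p 0)).1
  have h3 : ((A.image fun p => p 0).card : ℝ) ≤ n := by
    exact_mod_cast Finset.card_image_le.trans hcard
  have h4 := (envelope_strictAnti ℓ).antitone h3
  unfold firstCoords at h1
  linarith

lemma IsAdmissible.eq_alphaSet {n ℓ : ℕ} {α : Set Plane} (h : IsAdmissible constraintSet n α)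
    (hα : distortion planeCantor α = envelope ℓ n + (1 + 1 / (n : ℝ)) ^ 2) :
    ∃ I : Finset (List (Fin 2)), (∀ σ ∈ I, σ.length = ℓ) ∧ I.card = n - 2 ^ ℓ ∧
      α = alphaSet n ℓ I := by
  obtain ⟨A, hA, hcard, rfl⟩ := h.exists_finset
  have hlow : ∀ A' : Finset Plane, A' ⊆ A → A'.Nonempty →
      envelope ℓ n ≤ envelope ℓ (firstCoords A').card ∧
      envelope ℓ (firstCoords A').card ≤ lineDistortion (firstCoords A') := fun A' hs hA' => by
    refine ⟨(envelope_strictAnti ℓ).antitone ?_, (envelope_le_lineDistortion ℓ (hA'.image _)).1⟩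
    exact_mod_cast Finset.card_image_le.trans ((Finset.card_le_card hs).trans hcard)
  have h1 := lineDistortion_add_le_distortion hA (by positivity) fun p hp => h.le_snd hp
  obtain ⟨h2, h3⟩ := hlow A subset_rfl hA
  obtain ⟨A', hs, hA', hflat, hle⟩ := exists_flat_subset hA (by positivity)
    (fun p hp => h.le_snd hp) (by linarith)
  obtain ⟨h4, h5⟩ := hlow A' hs hA'
  -- The chain `envelope ℓ n`, `envelope ℓ (firstCoords A').card`, error of `A'`, error of `A`
  -- closes up, so `A'` has `n` distinct first coordinates and must be all of `A`.
  have h6 : ((firstCoords A').card : ℝ) = n := (envelope_strictAnti ℓ).injective (by linarith)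
  have h7 : (firstCoords A').card = n := by exact_mod_cast h6
  have h8 : (firstCoords A').card ≤ A'.card := Finset.card_image_le
  obtain rfl : A' = A := Finset.eq_of_subset_of_card_le hs (by omega)
  obtain ⟨I, hI, hIc, hs⟩ := (envelope_le_lineDistortion ℓ (hA.image fun p => p 0)).2
    (by unfold firstCoords at h1 h2 h3; linarith)
  change (firstCoords A').card = _ at hIc
  refine ⟨I, hI, by omega, ?_⟩
  rw [alphaSet_eq, ← hs, Finset.coe_image, Set.image_image]
  conv_lhs => rw [← Set.image_id (A' : Set Plane)]
  refine Set.image_congr fun p hp => ?_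
  ext i
  fin_cases i
  · simp
  · simpa using hflat p hp

lemma alphaSet_subset_constraintSet {n ℓ : ℕ} {I : Finset (List (Fin 2))}
    (hI : ∀ σ ∈ I, σ.length = ℓ) : alphaSet n ℓ I ⊆ constraintSet n := by
  obtain ⟨B, hs, -, -, hu, -⟩ := exists_finset_eq_betaSet hI
  rw [alphaSet_eq, ← hs]
  rintro _ ⟨x, hx, rfl⟩
  exact ⟨by simpa using (hu hx).1, by simpa using (hu hx).2, by simp⟩

lemma isAdmissible_alphaSet {n ℓ : ℕ} (hn : 2 ^ ℓ ≤ n) {I : Finset (List (Fin 2))}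
    (hI : ∀ σ ∈ I, σ.length = ℓ) (hIc : I.card = n - 2 ^ ℓ) :
    IsAdmissible constraintSet n (alphaSet n ℓ I) ∧
      distortion planeCantor (alphaSet n ℓ I) ≤ envelope ℓ n + (1 + 1 / (n : ℝ)) ^ 2 := by
  have hn1 : 1 ≤ n := Nat.one_le_two_pow.trans hn
  have hsub := alphaSet_subset_constraintSet (n := n) hI
  obtain ⟨B, hs, hB, hc, -, hD⟩ := exists_finset_eq_betaSet hI
  have hcast : (2 ^ ℓ + I.card : ℝ) = n := by
    rw [hIc, Nat.cast_sub hn]; push_cast; ring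
  rw [hcast] at hD
  set A : Finset Plane := B.image fun x : ℝ => !₂[x, 1 + 1 / (n : ℝ)] with hAdef
  have hA : A.Nonempty := hB.image _
  have hAα : alphaSet n ℓ I = A := by rw [alphaSet_eq, ← hs, hAdef, Finset.coe_image]
  have hf : firstCoords A = B := by
    rw [firstCoords, hAdef, Finset.image_image]
    exact (Finset.image_congr fun x _ => by simp).trans Finset.image_id
  have hcard : A.card ≤ n := Finset.card_image_le.trans (by omega)
  rw [hAα] at hsub ⊢
  refine ⟨⟨fun p hp => Set.mem_iUnion₂.mpr ⟨n, ⟨hn1, le_rfl⟩, hsub hp⟩, ?_, ?_⟩, ?_⟩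
  · rw [Set.one_le_encard_iff_nonempty]
    simpa using hA
  · rw [Set.encard_coe_eq_coe_finsetCard]
    exact_mod_cast hcard
  · have := distortion_le_of_flat hA (h := 1 + 1 / (n : ℝ)) fun p hp => (hsub hp).2.2
    rw [hf] at this
    linarith

lemma exists_words {ℓ m : ℕ} (hm : m ≤ 2 ^ ℓ) :
    ∃ I : Finset (List (Fin 2)), (∀ σ ∈ I, σ.length = ℓ) ∧ I.card = m := by
  have hc : (Finset.univ.image (List.ofFn : (Fin ℓ → Fin 2) → List (Fin 2))).card = 2 ^ ℓ := by
    rw [Finset.card_image_of_injective _ List.ofFn_injective]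
    simp
  obtain ⟨I, hI, hIc⟩ := Finset.exists_subset_card_eq (hm.trans_eq hc.symm)
  refine ⟨I, fun σ hσ => ?_, hIc⟩
  obtain ⟨f, -, rfl⟩ := Finset.mem_image.mp (hI hσ)
  simp

lemma quantError_eq_envelope {n ℓ : ℕ} (hn : 2 ^ ℓ ≤ n) (hn' : n < 2 ^ (ℓ + 1)) :
    quantError constraintSet planeCantor n = envelope ℓ n + (1 + 1 / (n : ℝ)) ^ 2 := by
  obtain ⟨I, hI, hIc⟩ := exists_words (ℓ := ℓ) (m := n - 2 ^ ℓ) (by rw [pow_succ] at hn'; omega)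
  obtain ⟨hadm, hle⟩ := isAdmissible_alphaSet hn hI hIc
  refine IsLeast.csInf_eq ⟨⟨_, hadm, le_antisymm (hadm.le_distortion ℓ) hle⟩, ?_⟩
  rintro _ ⟨α, hα, rfl⟩
  exact hα.le_distortion ℓ

theorem isOptimal_iff {n ℓ : ℕ} (hn : 2 ^ ℓ ≤ n) (hn' : n < 2 ^ (ℓ + 1)) (α : Set Plane) :
    IsOptimal constraintSet planeCantor n α ↔
      ∃ I : Finset (List (Fin 2)), (∀ σ ∈ I, σ.length = ℓ) ∧ I.card = n - 2 ^ ℓ ∧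
        α = alphaSet n ℓ I := by
  rw [IsOptimal, quantError_eq_envelope hn hn']
  constructor
  · rintro ⟨h, e⟩
    exact h.eq_alphaSet e
  · rintro ⟨I, hI, hIc, rfl⟩
    obtain ⟨hadm, hle⟩ := isAdmissible_alphaSet hn hI hIc
    exact ⟨hadm, le_antisymm hle (hadm.le_distortion ℓ)⟩

end CantorQuant

end

theorem mainTheorem4 :
    (∀ n : ℕ, 1 ≤ n → ∀ α : Set CantorQuant.Plane,
      CantorQuant.IsOptimal CantorQuant.constraintSet CantorQuant.planeCantor n α →
        α ⊆ CantorQuant.constraintSet n) ∧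
    (∀ n ℓ : ℕ, 2 ≤ n → 2 ^ ℓ ≤ n → n < 2 ^ (ℓ + 1) →
      (∀ α : Set CantorQuant.Plane,
        CantorQuant.IsOptimal CantorQuant.constraintSet CantorQuant.planeCantor n α ↔
          ∃ I : Finset (List (Fin 2)), (∀ σ ∈ I, σ.length = ℓ) ∧ I.card = n - 2 ^ ℓ ∧
            α = CantorQuant.alphaSet n ℓ I) ∧
      CantorQuant.quantError CantorQuant.constraintSet CantorQuant.planeCantor n =
        1 / 18 ^ ℓ * CantorQuant.V *
            (2 ^ (ℓ + 1) - (n : ℝ) + 1 / 9 * ((n : ℝ) - 2 ^ ℓ)) +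
          (1 + 1 / (n : ℝ)) ^ 2) := by
  open CantorQuant in
  refine ⟨fun n hn α hα => ?_, fun n ℓ _ hn hn' => ⟨isOptimal_iff hn hn', ?_⟩⟩
  -- The characterization also holds for `n = 1`, at level `0`, so containment in the last segment
  -- follows from it for all `n ≥ 1`.
  · obtain ⟨I, hI, -, rfl⟩ := (isOptimal_iff (Nat.pow_log_le_self 2 (by omega))
      (Nat.lt_pow_succ_log_self one_lt_two n) α).mp hα
    exact alphaSet_subset_constraintSet hI
  -- With `V = 1/8`, the stated bracket equals `(17 * 2^ℓ - 8 * n) / 9`, which gives the denominator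
  -- `72 = 8 * 9` of `envelope`.
  · rw [quantError_eq_envelope hn hn', V_eq, envelope, pow_succ]
    field_simp
    ring
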